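/- Graphs are finite and may have multiple edges and tadpoles. For a connected graph $G$ let $e_G$ be its number of edges, $h_G=\operatorname{rank} H_1(G;\mathbb Z)$ its number of loops, and call $e_G-2h_G$ its degree. Let $\Lambda_G=\mathcal H_G^T D_G\mathcal H_G$ be the graph Laplacian, where $\mathcal H_G$ is the matrix of $H_1(G;\mathbb Z)\hookrightarrow\mathbb Z^{E_G}$ in some basis of $H_1(G;\mathbb Z)$ and $D_G=\operatorname{diag}(x_e)_{e\in E_G}$; let $\Psi_G=\det\Lambda_G$. For $k\ge 1$ set $\omega_G^{4k+1}=\operatorname{tr}\big((\Lambda_G^{-1}d\Lambda_G)^{4k+1}\big)$, an algebraic differential form over $\mathbb Q$ on the complement of $\Psi_G=0$. Let $\Omega_{\mathrm{can}}$ be the graded exterior algebra over $\mathbb Q$ on symbols $\beta^{4k+1}$ of degree $4k+1$, $k\ge1$, with the coproduct (an algebra homomorphism to the graded tensor square) for which $\Delta\beta^{4k+1}=\beta^{4k+1}\otimes1+1\otimes\beta^{4k+1}$. Write $\omega\mapsto\omega_G$ for the algebra homomorphism with $\beta^{4k+1}\mapsto\omega_G^{4k+1}$. If $\omega$ has degree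 $n$ and $G$ has $n+1$ edges, then, for an orientation of $G$ (an ordering of its edges up to even permutations), put $I_G(\omega)=\int_{\sigma_G}\omega_G$, where $\sigma_G=\{x_e>0\}\subset\mathbb P^{E_G}(\mathbb R)$ is the open coordinate simplex. Let $\omega\in\Omega_{\mathrm{can}}$ be homogeneous of degree $n$ and primitive, i.e. $\Delta\omega=\omega\otimes1+1\otimes\omega$ (for example $\omega=\beta^{4k+1}$, $n=4k+1$). (1) Let $G$ be a connected graph with $e_G=n+1$ edges. If $e_G\neq 2h_G$, then $\omega_G=0$, and hence $I_G(\omega)=0$ for every orientation of $G$. (2) Let $\mathcal{GC}_2$ be the graph complex: the $\mathbb Q$-vector space generated by oriented connected graphs $(G,\eta)$ without tadpoles and without vertices of degree $\le2$, modulo $(G,-\eta)=-(G,\eta)$ and isomorphism, with differential $d[G,e_1\wedge\dots\wedge e_m]=\sum_i(-1)^i[G/e_i,e_1\wedge\dots\widehat{e_i}\dots\wedge e_m]$ (a term whose contracted graph has a tadpole is zero). Extend $I(\omega)$ linearly to formal linear combinations of oriented graphs, graphs with $e_G\ne n+1$ contributing $0$. If, for some class $\xi\in H_p(\mathcal{GC}_2)$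 of degree $p$, the integral $I(\omega)$ is non-zero on some formal linear combination of oriented graphs of degree $p$ representing $\xi$, then $p=0$. -/

import Mathlib

noncomputable section

open scoped TensorProduct KaehlerDifferential

/-! ### Maurer-Cartan forms and invariant traces -/

section MaurerCartan

/-- In an exterior algebra over a `ℚ`-algebra, odd elements have square zero. -/
theorem ExteriorAlgebra.odd_mul_self_eq_zero {A M : Type} [CommRing A] [Algebra ℚ A]
    [AddCommGroup M] [Module A M] (x : ExteriorAlgebra A M)
    (hx : x ∈ CliffordAlgebra.evenOdd (0 : QuadraticForm A M) 1) : x * x = 0 := by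
  have swap : ∀ a b : M, ExteriorAlgebra.ι A a * ExteriorAlgebra.ι A b
      = -(ExteriorAlgebra.ι A b * ExteriorAlgebra.ι A a) := fun a b =>
    eq_neg_of_add_eq_zero_left (ExteriorAlgebra.ι_add_mul_swap a b)
  have h1 : ∀ (y : ExteriorAlgebra A M), y ∈ CliffordAlgebra.evenOdd (0 : QuadraticForm A M) 1 →
      ∀ m : M, y * ExteriorAlgebra.ι A m = -(ExteriorAlgebra.ι A m * y) := by
    intro y hy
    induction y, hy using CliffordAlgebra.odd_induction with
    | ι v => intro m; exact swap v m
    | add x y hx hy ihx ihy => intro m; rw [add_mul, ihx, ihy, mul_add, neg_add]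
    | ι_mul_ι_mul a b x hx ih =>
      intro m
      change ExteriorAlgebra.ι A a * ExteriorAlgebra.ι A b * x * ExteriorAlgebra.ι A m
        = -(ExteriorAlgebra.ι A m * (ExteriorAlgebra.ι A a * ExteriorAlgebra.ι A b * x))
      rw [mul_assoc, ih m, mul_neg, ← mul_assoc, mul_assoc (ExteriorAlgebra.ι A a), swap b m,
        mul_neg, ← mul_assoc, swap a m]
      simp only [neg_mul, neg_neg, mul_assoc]
  have h2 : ∀ (y : ExteriorAlgebra A M), y ∈ CliffordAlgebra.evenOdd (0 : QuadraticForm A M) 1 →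
      x * y = -(y * x) := by
    intro y hy
    induction y, hy using CliffordAlgebra.odd_induction with
    | ι v => exact h1 x hx v
    | add y z hy hz ihy ihz => rw [mul_add, ihy, ihz, add_mul, neg_add]
    | ι_mul_ι_mul a b y hy ih =>
      change x * (ExteriorAlgebra.ι A a * ExteriorAlgebra.ι A b * y)
        = -(ExteriorAlgebra.ι A a * ExteriorAlgebra.ι A b * y * x)
      rw [← mul_assoc, ← mul_assoc, h1 x hx a, neg_mul, mul_assoc _ x, h1 x hx b, mul_neg, neg_neg,
        mul_assoc, mul_assoc _ x, ih, mul_neg, mul_neg]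
      simp only [mul_assoc]
  have h3 : (2 : A) • (x * x) = 0 := by
    rw [two_smul]
    nth_rewrite 1 [h2 x hx]
    exact neg_add_cancel _
  have h4 : (algebraMap ℚ A 2⁻¹) * 2 = 1 := by
    rw [← map_ofNat (algebraMap ℚ A) 2, ← map_mul]
    norm_num
  rw [← one_smul A (x * x), ← h4, mul_smul, h3, smul_zero]

variable {A M ν : Type} [CommRing A] [Algebra ℚ A] [AddCommGroup M] [Module A M] [Module ℚ M]
  [Fintype ν] [DecidableEq ν]

/-- The matrix of one-forms `μ_X = X⁻¹ dX`, with entries in the exterior algebra. -/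
def maurerCartan (d : Derivation ℚ A M) (X : Matrix ν ν A) :
    Matrix ν ν (ExteriorAlgebra A M) :=
  X⁻¹.map (algebraMap A (ExteriorAlgebra A M)) * X.map (fun a => ExteriorAlgebra.ι A (d a))

/-- The invariant trace `β^m_X = tr ((X⁻¹ dX)^m)`. -/
def invariantTrace (d : Derivation ℚ A M) (m : ℕ) (X : Matrix ν ν A) : ExteriorAlgebra A M :=
  ((maurerCartan d X) ^ m).trace

theorem invariantTrace_mem (d : Derivation ℚ A M) (m : ℕ) (X : Matrix ν ν A) :
    invariantTrace d m X ∈ CliffordAlgebra.evenOdd (0 : QuadraticForm A M) (m : ZMod 2) := by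
  have h1 : ∀ i j, maurerCartan d X i j
      ∈ CliffordAlgebra.evenOdd (0 : QuadraticForm A M) 1 := by
    intro i j
    refine Submodule.sum_mem _ fun l _ => ?_
    simp only [Matrix.map_apply]
    rw [← Algebra.smul_def]
    exact Submodule.smul_mem _ _ (CliffordAlgebra.ι_mem_evenOdd_one _ _)
  have h2 : ∀ (m : ℕ) (i j : ν), ((maurerCartan d X) ^ m) i j
      ∈ CliffordAlgebra.evenOdd (0 : QuadraticForm A M) (m : ZMod 2) := by
    intro m
    induction m with
    | zero =>
      intro i j
      rw [pow_zero, Matrix.one_apply]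
      split_ifs
      · simpa using SetLike.GradedOne.one_mem (A := CliffordAlgebra.evenOdd (0 : QuadraticForm A M))
      · exact Submodule.zero_mem _
    | succ m ih =>
      intro i j
      rw [pow_succ, Matrix.mul_apply, Nat.cast_succ]
      exact Submodule.sum_mem _ fun l _ => SetLike.GradedMul.mul_mem (ih i l) (h1 l j)
  exact Submodule.sum_mem _ fun i _ => h2 m i i

end MaurerCartan

/-! ### The Hopf algebra of canonical forms -/

/-- The exterior algebra over `ℚ` on symbols `β^{4k+1}`, `k ≥ 1`. -/
abbrev OmegaCan : Type := ExteriorAlgebra ℚ (ℕ+ →₀ ℚ)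

namespace OmegaCan

/-- The generator `β^{4k+1}`. -/
def β (k : ℕ+) : OmegaCan := ExteriorAlgebra.ι ℚ (Finsupp.single k 1)

/-- The canonical forms of degree `n`: the span of the products of generators `β^{4k+1}` whose
degrees `4k+1` add up to `n`. -/
def homogeneous (n : ℕ) : Submodule ℚ OmegaCan :=
  Submodule.span ℚ
    {x | ∃ l : List ℕ+, (l.map fun k => 4 * (k : ℕ) + 1).sum = n ∧ x = (l.map β).prod}

/-- The grading by the number of generators. Since all generators have odd degree, it has the same
parity as the degree, so that it gives the usual (Koszul) signs on the tensor square. -/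
abbrev wordGrading (i : ℕ) : Submodule ℚ OmegaCan := ⋀[ℚ]^i (ℕ+ →₀ ℚ)

/-- The graded tensor product `Ω_can ⊗ Ω_can`, with
`(a ⊗ b) (a' ⊗ b') = (-1)^(deg b * deg a') a a' ⊗ b b'`. -/
abbrev TensorSquare : Type := wordGrading ᵍ⊗[ℚ] wordGrading

/-- The linear map `v ↦ v ⊗ 1 + 1 ⊗ v` on the span of the generators. -/
def coproductOnGenerators : (ℕ+ →₀ ℚ) →ₗ[ℚ] TensorSquare :=
  (GradedTensorProduct.includeLeft wordGrading wordGrading).toLinearMap ∘ₗ ExteriorAlgebra.ι ℚ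
    + (GradedTensorProduct.includeRight wordGrading wordGrading).toLinearMap ∘ₗ
      ExteriorAlgebra.ι ℚ

theorem coproductOnGenerators_mul_self (v : ℕ+ →₀ ℚ) :
    coproductOnGenerators v * coproductOnGenerators v = 0 := by
  have hv : ExteriorAlgebra.ι ℚ v ∈ wordGrading 1 := by
    simp [wordGrading]
  have e1 : coproductOnGenerators v =
      GradedTensorProduct.includeLeft wordGrading wordGrading (ExteriorAlgebra.ι ℚ v)
      + GradedTensorProduct.includeRight wordGrading wordGrading (ExteriorAlgebra.ι ℚ v) := rfl
  have e2 : GradedTensorProduct.includeLeft wordGrading wordGrading (ExteriorAlgebra.ι ℚ v)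
      * GradedTensorProduct.includeRight wordGrading wordGrading (ExteriorAlgebra.ι ℚ v)
      = (ExteriorAlgebra.ι ℚ v) ᵍ⊗ₜ[ℚ] (ExteriorAlgebra.ι ℚ v) :=
    GradedTensorProduct.tmul_one_mul_one_tmul wordGrading wordGrading _ _
  have e3 : GradedTensorProduct.includeRight wordGrading wordGrading (ExteriorAlgebra.ι ℚ v)
      * GradedTensorProduct.includeLeft wordGrading wordGrading (ExteriorAlgebra.ι ℚ v)
      = -((ExteriorAlgebra.ι ℚ v) ᵍ⊗ₜ[ℚ] (ExteriorAlgebra.ι ℚ v)) := by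
    have := GradedTensorProduct.tmul_coe_mul_coe_tmul (R := ℚ) wordGrading wordGrading
      (1 : OmegaCan) (⟨ExteriorAlgebra.ι ℚ v, hv⟩ : wordGrading 1)
      (⟨ExteriorAlgebra.ι ℚ v, hv⟩ : wordGrading 1) (1 : OmegaCan)
    simpa using this
  have e4 : GradedTensorProduct.includeLeft wordGrading wordGrading (ExteriorAlgebra.ι ℚ v)
      * GradedTensorProduct.includeLeft wordGrading wordGrading (ExteriorAlgebra.ι ℚ v) = 0 :=
    ExteriorAlgebra.comp_ι_sq_zero (GradedTensorProduct.includeLeft wordGrading wordGrading) v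
  have e5 : GradedTensorProduct.includeRight wordGrading wordGrading (ExteriorAlgebra.ι ℚ v)
      * GradedTensorProduct.includeRight wordGrading wordGrading (ExteriorAlgebra.ι ℚ v) = 0 :=
    ExteriorAlgebra.comp_ι_sq_zero (GradedTensorProduct.includeRight wordGrading wordGrading) v
  rw [e1, add_mul, mul_add, mul_add, e2, e3, e4, e5, zero_add, add_zero, add_neg_cancel]

/-- The coproduct: the algebra homomorphism with `Δ β^{4k+1} = β^{4k+1} ⊗ 1 + 1 ⊗ β^{4k+1}`. -/
def coproduct : OmegaCan →ₐ[ℚ] TensorSquare :=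
  ExteriorAlgebra.lift ℚ ⟨coproductOnGenerators, coproductOnGenerators_mul_self⟩

/-- Primitive elements: `Δ ω = ω ⊗ 1 + 1 ⊗ ω`. -/
def IsPrimitive (ω : OmegaCan) : Prop :=
  coproduct ω = ω ᵍ⊗ₜ[ℚ] (1 : OmegaCan) + (1 : OmegaCan) ᵍ⊗ₜ[ℚ] ω

end OmegaCan

/-! ### Graphs -/

/-- A finite graph; multiple edges and tadpoles are allowed. Every edge carries a reference
direction from `src` to `tgt`, which isomorphisms need not respect. -/
structure MultiGraph where
  V : Type
  E : Type
  [finV : Fintype V]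
  [finE : Fintype E]
  src : E → V
  tgt : E → V

attribute [instance] MultiGraph.finV MultiGraph.finE

namespace MultiGraph

variable (G : MultiGraph)

def IsConnected : Prop :=
  Nonempty G.V ∧
    ∀ u v : G.V, Relation.EqvGen (fun a b => ∃ e : G.E, G.src e = a ∧ G.tgt e = b) u v

open Classical in
/-- The boundary map `ℤ^E → ℤ^V`, `e ↦ src e - tgt e`. -/
def boundary : (G.E → ℤ) →ₗ[ℤ] (G.V → ℤ) :=
  Matrix.mulVecLin (Matrix.of fun (v : G.V) (e : G.E) =>
    (if G.src e = v then (1 : ℤ) else 0) - (if G.tgt e = v then (1 : ℤ) else 0))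

/-- `H_1(G; ℤ)`. -/
abbrev H1 : Submodule ℤ (G.E → ℤ) := LinearMap.ker G.boundary

/-- The number of edges `e_G`. -/
def numEdges : ℕ := Fintype.card G.E

/-- The number of loops `h_G`, i.e. the rank of `H_1(G; ℤ)`. -/
def loops : ℕ := Module.finrank ℤ G.H1

/-- The degree `e_G - 2 h_G`. -/
def degree : ℤ := (G.numEdges : ℤ) - 2 * (G.loops : ℤ)

/-- A basis of `H_1(G; ℤ)`. -/
def cycleBasis : Module.Basis (Fin G.loops) ℤ G.H1 := Module.finBasis ℤ G.H1

/-- The polynomial ring `ℚ[x_e, e ∈ E]`. -/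
abbrev Poly : Type := MvPolynomial G.E ℚ

/-- The edge-cycle incidence matrix. -/
def cycleMatrix : Matrix G.E (Fin G.loops) G.Poly :=
  Matrix.of fun e c => (((G.cycleBasis c : G.E → ℤ) e : ℤ) : G.Poly)

open Classical in
/-- The graph Laplacian matrix `Λ_G = Hᵀ D H`. -/
def laplacian : Matrix (Fin G.loops) (Fin G.loops) G.Poly :=
  (Matrix.transpose G.cycleMatrix : Matrix (Fin G.loops) G.E G.Poly) *
    (Matrix.diagonal (fun e => MvPolynomial.X e) : Matrix G.E G.E G.Poly) * G.cycleMatrix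

/-- The graph polynomial `Ψ_G`. -/
def graphPoly : G.Poly := G.laplacian.det

/-- The ring `R_G^0 = ℚ[x_e, Ψ_G⁻¹]`. -/
abbrev R0 : Type := Localization.Away G.graphPoly

/-- The algebra `R_G^•` of Kähler differential forms on the complement of the graph
hypersurface. -/
abbrev Forms : Type := ExteriorAlgebra G.R0 Ω[G.R0⁄ℚ]

/-- The canonical form `ω_G^{4k+1}`, the invariant trace of the graph Laplacian. -/
def primitiveForm (k : ℕ) : G.Forms :=
  invariantTrace (KaehlerDifferential.D ℚ G.R0) (4 * k + 1)
    (G.laplacian.map (algebraMap G.Poly G.R0))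

/-- The linear extension of `β^{4k+1} ↦ ω_G^{4k+1}`. -/
def formOnGenerators : (ℕ+ →₀ ℚ) →ₗ[ℚ] G.Forms :=
  Finsupp.linearCombination ℚ fun k : ℕ+ => G.primitiveForm k

theorem formOnGenerators_mul_self (v : ℕ+ →₀ ℚ) :
    G.formOnGenerators v * G.formOnGenerators v = 0 := by
  apply ExteriorAlgebra.odd_mul_self_eq_zero
  rw [formOnGenerators, Finsupp.linearCombination_apply]
  refine Submodule.sum_mem _ fun k _ => ?_
  dsimp only
  rw [← algebraMap_smul G.R0 (v k)]
  refine Submodule.smul_mem _ _ ?_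
  have h := invariantTrace_mem (KaehlerDifferential.D ℚ G.R0) (4 * (k : ℕ) + 1)
    (G.laplacian.map (algebraMap G.Poly G.R0))
  have h4 : ((4 * (k : ℕ) + 1 : ℕ) : ZMod 2) = 1 := by
    push_cast
    rw [show (4 : ZMod 2) = 0 from rfl]
    simp
  rwa [h4] at h

/-- The homomorphism of algebras `ω ↦ ω_G`, which sends `β^{4k+1}` to `ω_G^{4k+1}`. -/
def canonicalForm : OmegaCan →ₐ[ℚ] G.Forms :=
  ExteriorAlgebra.lift ℚ ⟨G.formOnGenerators, G.formOnGenerators_mul_self⟩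

/-! ### Integrals -/

/-- The basis `dx_e`, `e ∈ E`, of the module of Kähler differentials of `R_G^0`. -/
def dxBasis : Module.Basis G.E G.R0 Ω[G.R0⁄ℚ] :=
  haveI : Algebra.FormallyEtale G.Poly G.R0 :=
    Algebra.FormallyEtale.of_isLocalization (Submonoid.powers G.graphPoly)
  ((KaehlerDifferential.mvPolynomialBasis ℚ G.E).baseChange G.R0).map
    (KaehlerDifferential.tensorKaehlerEquivOfFormallyEtale ℚ G.Poly G.R0)

/-- The coefficient of `dx_{f 0} ∧ ⋯ ∧ dx_{f (k-1)}` in a differential form, for an injective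
family of edges `f`. -/
def coefficient {k : ℕ} (f : Fin k → G.E) : G.Forms →ₗ[G.R0] G.R0 :=
  ExteriorAlgebra.liftAlternating
    (Pi.single k (Matrix.detRowAlternating.compLinearMap
      (LinearMap.pi fun i => G.dxBasis.coord (f i))))

open Classical in
/-- The value of a function in `R_G^0` at a real point where `Ψ_G` does not vanish (in particular
at points with positive coordinates), and `0` on the graph hypersurface. -/
def realValue (r : G.R0) (x : G.E → ℝ) : ℝ :=
  if h : IsUnit ((MvPolynomial.aeval x : G.Poly →ₐ[ℚ] ℝ) G.graphPoly) then
    IsLocalization.Away.lift (g := (MvPolynomial.aeval x : G.Poly →ₐ[ℚ] ℝ).toRingHom)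
      G.graphPoly h r
  else 0

/-- The integral over the open coordinate simplex `σ_G ⊂ ℙ(ℝ^E)` of a projective differential form
of degree `k`, for a graph with `k + 1` edges, ordered (hence oriented) by `o`. The simplex is
identified with the positive orthant by the chart `x_{o 0} = 1`, with coordinates
`x_{o 1}, …, x_{o k}` in this order. -/
def simplexIntegral {k : ℕ} (o : Fin (k + 1) ≃ G.E) (η : G.Forms) : ℝ :=
  ∫ y in {y : Fin k → ℝ | ∀ i, 0 < y i},
    G.realValue (G.coefficient (fun i => o i.succ) η)
      (fun e => (Fin.cons 1 y : Fin (k + 1) → ℝ) (o.symm e))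

/-- The canonical integral `I_G(ω) = ∫_{σ_G} ω_G`. -/
def canonicalIntegral {k : ℕ} (o : Fin (k + 1) ≃ G.E) (ω : OmegaCan) : ℝ :=
  G.simplexIntegral o (G.canonicalForm ω)

/-! ### The graph complex -/

open Classical in
/-- The valency of a vertex; tadpoles count twice. -/
def valency (v : G.V) : ℕ :=
  (Finset.univ.filter fun e => G.src e = v).card + (Finset.univ.filter fun e => G.tgt e = v).card

/-- Connected, without tadpoles, and without vertices of valency at most two. -/
def IsAdmissible : Prop :=
  G.IsConnected ∧ (∀ e, G.src e ≠ G.tgt e) ∧ ∀ v, 3 ≤ G.valency v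

open Classical in
/-- The graph obtained by removing an edge and identifying its endpoints. -/
def contract (e : G.E) : MultiGraph where
  V := Quot fun a b => a = G.src e ∧ b = G.tgt e
  E := {f : G.E // f ≠ e}
  finV := Fintype.ofFinite _
  finE := Fintype.ofFinite _
  src f := Quot.mk _ (G.src f)
  tgt f := Quot.mk _ (G.tgt f)

/-- The ordering induced on the edges of `G / e_i` by an ordering `e_0, e_1, …` of the
edges of `G`. -/
def contractOrder {m : ℕ} (o : Fin (m + 1) ≃ G.E) (i : Fin (m + 1)) :
    Fin m ≃ (G.contract (o i)).E :=
  (finSuccAboveEquiv i).trans (o.subtypeEquiv fun j => by simp)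

/-- Isomorphisms of graphs, which need not respect the reference directions of edges. -/
structure Iso (G G' : MultiGraph) where
  onV : G.V ≃ G'.V
  onE : G.E ≃ G'.E
  ends : ∀ e, s(G'.src (onE e), G'.tgt (onE e)) = s(onV (G.src e), onV (G.tgt e))

end MultiGraph

/-- A generator of the graph complex: an admissible graph, together with the orientation
`e_0 ∧ ⋯ ∧ e_{n-1}` given by an ordering of its edges. -/
structure OrientedGraph where
  G : MultiGraph
  n : ℕ
  ord : Fin n ≃ G.E
  adm : G.IsAdmissible

namespace GraphComplex

/-- Formal rational linear combinations of oriented graphs. -/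
abbrev Chain : Type 1 := OrientedGraph →₀ ℚ

/-- The relations: a permutation of the edges multiplies the orientation by its sign, and
isomorphic oriented graphs are identified. -/
def relations : Submodule ℚ Chain :=
  Submodule.span ℚ
    ({c | ∃ (G : MultiGraph) (n : ℕ) (o : Fin n ≃ G.E) (h : G.IsAdmissible)
        (s : Equiv.Perm (Fin n)),
        c = Finsupp.single ⟨G, n, s.trans o, h⟩ 1
          - ((Equiv.Perm.sign s : ℤ) : ℚ) • Finsupp.single ⟨G, n, o, h⟩ 1} ∪
     {c | ∃ (G G' : MultiGraph) (φ : MultiGraph.Iso G G') (n : ℕ) (o : Fin n ≃ G.E)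
        (h : G.IsAdmissible) (h' : G'.IsAdmissible),
        c = Finsupp.single ⟨G, n, o, h⟩ 1 - Finsupp.single ⟨G', n, o.trans φ.onE, h'⟩ 1})

open Classical in
/-- The differential of a generator, `∑ (-1)^i [G/e_i, e_1 ∧ ⋯ ê_i ⋯ ∧ e_n]`, `i = 1, …, n`. The
contraction has tadpoles only if `e_i` is one of several parallel edges; such a `G` is zero in the
graph complex, and the term is omitted. -/
def boundaryGen : OrientedGraph → Chain
  | ⟨_, 0, _, _⟩ => 0
  | ⟨G, n + 1, o, _⟩ => ∑ i : Fin (n + 1), (-1 : ℚ) ^ ((i : ℕ) + 1) •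
      if h : (G.contract (o i)).IsAdmissible then
        Finsupp.single ⟨G.contract (o i), n, G.contractOrder o i, h⟩ 1
      else 0

/-- The differential, on formal linear combinations. -/
def boundary : Chain →ₗ[ℚ] Chain := Finsupp.linearCombination ℚ boundaryGen

/-- Formal linear combinations of oriented graphs of degree `e_G - 2 h_G = p` whose boundary is
zero in the graph complex. -/
def cycles (p : ℤ) : Submodule ℚ Chain :=
  Finsupp.supported ℚ ℚ {X : OrientedGraph | X.G.degree = p} ⊓ relations.comap boundary

/-- The graph homology `H_p` of the graph complex `Chain ⧸ relations`. -/
abbrev Homology (p : ℤ) : Type 1 :=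
  cycles p ⧸ (LinearMap.range boundary ⊔ relations).comap (cycles p).subtype

/-- The integral of a canonical form of degree `k` over a formal linear combination of oriented
graphs; only graphs with `k + 1` edges contribute. -/
def integral (k : ℕ) (ω : OmegaCan) : Chain →ₗ[ℚ] ℝ :=
  Finsupp.linearCombination ℚ fun X : OrientedGraph =>
    if h : X.n = k + 1 then X.G.canonicalIntegral ((finCongr h.symm).trans X.ord) ω else 0

/-- Integration of `ω`, of degree `k`, detects a homology class if it is non-zero on some cycle
representing this class. -/
def Detects (k : ℕ) (ω : OmegaCan) {p : ℤ} (ξ : Homology p) : Prop :=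
  ∃ z : cycles p, Submodule.Quotient.mk z = ξ ∧ integral k ω (z : Chain) ≠ 0

end GraphComplex

end

/-! A primitive form is a combination of generators. Multiplication after the coproduct scales a
product of r generators by 2^r, while a primitive ω is sent to 2ω, so only r = 1 survives. It
remains to show that tr((Λ⁻¹dΛ)^(m+1)) = 0, with m = 4k > 0, when there are m + 2 edges and h ≠ (m +
2)/2 loops.

If 2h ≤ m + 1, this is the Amitsur-Levitzki theorem: an h × h matrix M with anticommuting entries
satisfies M^(2h) = 0. Following Rosset, M² has entries in a commutative ring and its positive powers
are traceless, so it is nilpotent.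

If 2h > m + 2, write Λ = HᵀDH and pass to the edge side. Cyclicity turns the trace into
tr((Pδ)^(m+1)), where P = HΛ⁻¹HᵀD is a projector of rank h and δ = diag(dx_e/x_e). Since δ² = 0 and
m is even, replacing P by 1 - P only changes the sign (`Matrix.trace_mul_diagonal_pow_eq_neg`). Now
1 - P has rank m + 2 - h, small enough for Amitsur-Levitzki.

The statement about homology follows because the integral already vanishes on each graph of degree p
≠ 0. -/

/-! ### Nilpotency from vanishing traces of powers. -/

open Polynomial in
/-- Jacobi's formula for matrices of polynomials. -/
theorem Matrix.derivative_det_eq_trace {R n : Type*} [CommRing R] [Fintype n] [DecidableEq n]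
    (A : Matrix n n R[X]) :
    derivative A.det = (A.adjugate * A.map derivative).trace := by
  -- The Leibniz expansion is indexed by columns, so the differentiated factor in column i lies in
  -- row σ i; reindexing by σ gathers the terms by row.
  have h2 : derivative A.det = ∑ i, (A.updateRow i (fun j => derivative (A i j))).det := by
    simp_rw [Matrix.det_apply', Polynomial.derivative_sum]
    rw [Finset.sum_comm]
    refine Finset.sum_congr rfl fun σ _ => ?_
    rw [Polynomial.derivative_intCast_mul, ← Finset.mul_sum, Polynomial.derivative_prod_finset]
    congr 1
    refine Fintype.sum_equiv σ _ _ fun i => ?_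
    rw [← Finset.mul_prod_erase _ _ (Finset.mem_univ i), mul_comm]
    congr 1
    · simp
    · refine Finset.prod_congr rfl fun k hk => ?_
      rw [Matrix.updateRow_ne]
      exact fun h => (Finset.ne_of_mem_erase hk) (σ.injective h)
  rw [h2, Matrix.trace_mul_comm]
  refine Finset.sum_congr rfl fun i _ => ?_
  rw [Matrix.diag_apply, Matrix.mul_apply, ← Matrix.cramer_transpose_apply,
    Matrix.cramer_eq_adjugate_mulVec, ← Matrix.adjugate_transpose, Matrix.mulVec, dotProduct]
  exact Finset.sum_congr rfl fun j _ => mul_comm _ _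

open Polynomial in
/-- A matrix over a commutative `ℚ`-algebra all of whose positive powers are traceless is
nilpotent. -/
theorem Matrix.pow_card_eq_zero_of_trace_pow_eq_zero {R n : Type*} [CommRing R] [Algebra ℚ R]
    [Fintype n] [DecidableEq n] (N : Matrix n n R) (hN : ∀ i, (N ^ (i + 1)).trace = 0) :
    N ^ Fintype.card n = 0 := by
  nontriviality R
  set A : Matrix n n R[X] := 1 - (X : R[X]) • N.map C with hA
  have hP : N.charpolyRev = A.det := rfl
  -- This is adj(A) A = det(A) rewritten with A = 1 - XN.
  have hB : A.adjugate = A.det • (1 : Matrix n n R[X]) + (X : R[X]) • (A.adjugate * N.map C) := by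
    rw [← Matrix.adjugate_mul, hA, mul_sub, mul_one, mul_smul_comm, sub_add_cancel]
  have hpow : ∀ i, (N.map C ^ (i + 1)).trace = (0 : R[X]) := fun i => by
    rw [← Matrix.map_pow, ← map_zero (C : R →+* R[X]), ← hN i]
    exact (map_sum (C : R →+* R[X]) _ _).symm
  -- By `hB` and tracelessness, each of these traces is X times the next one; iterating makes it
  -- divisible by every power of X, hence zero.
  have hdvd : ∀ k i, (X : R[X]) ^ k ∣ (A.adjugate * N.map C ^ (i + 1)).trace := by
    intro k
    induction k with
    | zero => intro i; simp
    | succ k ih =>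
      intro i
      rw [hB, add_mul, smul_mul_assoc, one_mul, smul_mul_assoc, mul_assoc, ← pow_succ',
        Matrix.trace_add, Matrix.trace_smul, Matrix.trace_smul, hpow, smul_zero, zero_add,
        smul_eq_mul, pow_succ']
      exact mul_dvd_mul_left _ (ih (i + 1))
  have htr : (A.adjugate * N.map C).trace = 0 := by
    by_contra h
    have h3 := hdvd ((A.adjugate * N.map C).trace.natDegree + 1) 0
    rw [zero_add, pow_one, X_pow_dvd_iff] at h3
    exact h (leadingCoeff_eq_zero.1 (h3 _ (Nat.lt_succ_self _)))
  have hd : derivative A.det = 0 := by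
    rw [Matrix.derivative_det_eq_trace]
    have : A.map derivative = -N.map C := by
      ext1 i j
      by_cases hij : i = j <;> simp [hA, hij]
    rw [this, mul_neg, Matrix.trace_neg, htr, neg_zero]
  have hone : N.charpolyRev = 1 := by
    rw [hP]
    have : IsAddTorsionFree R := .of_module_rat R
    have h4 := Polynomial.derivative_eq_zero.1 hd
    rw [Polynomial.eq_C_of_natDegree_eq_zero h4, coeff_zero_eq_eval_zero, ← hP,
      Matrix.eval_charpolyRev, map_one]
  -- Reversal forgets powers of X, so the known degree of the characteristic polynomial is needed to
  -- recover it from its reverse.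
  have hchar : N.charpoly = X ^ Fintype.card n := by
    have hr : N.charpoly.reverse = 1 := by rw [Matrix.reverse_charpoly, hone]
    ext i
    rw [coeff_X_pow]
    by_cases hi : i ≤ N.charpoly.natDegree
    · have h5 := N.charpoly.coeff_reverse (revAt N.charpoly.natDegree i)
      rw [revAt_invol, revAt_le hi, hr, coeff_one, N.charpoly_natDegree_eq_dim] at h5
      rw [N.charpoly_natDegree_eq_dim] at hi
      rw [← h5]
      exact if_congr (by omega) rfl rfl
    · rw [coeff_eq_zero_of_natDegree_lt (not_le.1 hi), if_neg]
      rintro rfl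
      exact hi N.charpoly_natDegree_eq_dim.ge
  have := N.aeval_self_charpoly
  rwa [hchar, map_pow, aeval_X] at this

/-! ### Matrices with anticommuting entries: the Amitsur-Levitzki theorem. -/

theorem Matrix.trace_mul_comm_of_commute {n p Γ : Type*} [Ring Γ] [Fintype n] [Fintype p]
    (A : Matrix n p Γ) (B : Matrix p n Γ) (h : ∀ i j, A i j * B j i = B j i * A i j) :
    (A * B).trace = (B * A).trace := by
  simp_rw [Matrix.trace, Matrix.diag_apply, Matrix.mul_apply]
  rw [Finset.sum_comm]
  exact Finset.sum_congr rfl fun i _ => Finset.sum_congr rfl fun j _ => h j i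

/-- Moving t past a product of m entries costs one sign per factor. -/
theorem Matrix.mul_pow_apply_of_anticommute {n Γ : Type*} [Ring Γ] [Fintype n] [DecidableEq n]
    (M : Matrix n n Γ) (t : Γ) (h : ∀ i j, t * M i j = -(M i j * t)) (m : ℕ) (i j : n) :
    t * (M ^ m) i j = (-1) ^ m * ((M ^ m) i j * t) := by
  induction m generalizing j with
  | zero => by_cases hij : i = j <;> simp [hij]
  | succ m ih =>
    rw [pow_succ, Matrix.mul_apply, Finset.mul_sum, Finset.sum_mul, Finset.mul_sum]
    refine Finset.sum_congr rfl fun k _ => ?_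
    rw [← mul_assoc, ih, mul_assoc, mul_assoc, h, pow_succ]
    simp [mul_assoc]

/-- Rosset's argument. Lifting M² to a commutative ring makes determinants and Cayley-Hamilton
available there. -/
theorem Matrix.pow_two_mul_card_eq_zero_of_sq_eq_map {n Γ C : Type*} [Ring Γ] [Algebra ℚ Γ]
    [CommRing C] [Algebra ℚ C] [Fintype n] [DecidableEq n] (M : Matrix n n Γ)
    (h : ∀ i j k l, M i j * M k l = -(M k l * M i j)) (f : C →+* Γ)
    (hf : Function.Injective f) (N : Matrix n n C) (hN : N.map f = M ^ 2) :
    M ^ (2 * Fintype.card n) = 0 := by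
  have hNp : ∀ i, (N ^ i).map f = M ^ (2 * i) := fun i => by
    rw [pow_mul, ← hN, Matrix.map_pow]
  have h0 : N ^ Fintype.card n = 0 := by
    apply Matrix.pow_card_eq_zero_of_trace_pow_eq_zero
    intro i
    apply hf
    have e : f (N ^ (i + 1)).trace = (M ^ (2 * (i + 1))).trace := by
      rw [← hNp]
      exact map_sum f _ _
    rw [e, map_zero]
    -- Cycling an odd entry past an odd number of odd entries gives a sign, so traces of even powers
    -- equal their negatives.
    have e2 : (M * M ^ (2 * i + 1)).trace = -(M ^ (2 * i + 1) * M).trace := by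
      simp_rw [Matrix.trace, Matrix.diag_apply, Matrix.mul_apply]
      rw [← Finset.sum_neg_distrib, Finset.sum_comm]
      refine Finset.sum_congr rfl fun a _ => ?_
      rw [← Finset.sum_neg_distrib]
      refine Finset.sum_congr rfl fun b _ => ?_
      rw [Matrix.mul_pow_apply_of_anticommute M _ (fun k l => h b a k l)]
      simp [pow_succ]
    rw [← pow_succ, ← pow_succ'] at e2
    have : IsAddTorsionFree Γ := .of_module_rat Γ
    exact self_eq_neg.1 e2
  rw [← hNp, h0]
  exact Matrix.map_zero _ (map_zero f)

open scoped IsMulCommutative in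
/-- The Amitsur-Levitzki theorem, for a matrix whose entries anticommute. -/
theorem Matrix.pow_two_mul_card_eq_zero_of_anticommute {n Γ : Type*} [Ring Γ] [Algebra ℚ Γ]
    [Fintype n] [DecidableEq n] (M : Matrix n n Γ)
    (h : ∀ i j k l, M i j * M k l = -(M k l * M i j)) : M ^ (2 * Fintype.card n) = 0 := by
  -- Products of two anticommuting entries commute with each other, so they generate a commutative
  -- algebra containing the entries of M².
  let S : Set Γ := {x | ∃ i j k l, x = M i j * M k l}
  have hS : ∀ a ∈ S, ∀ b ∈ S, a * b = b * a := by
    rintro _ ⟨i, j, k, l, rfl⟩ _ ⟨i', j', k', l', rfl⟩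
    calc M i j * M k l * (M i' j' * M k' l')
        = M i j * (M k l * M i' j') * M k' l' := by simp only [mul_assoc]
      _ = -(M i j * M i' j' * (M k l * M k' l')) := by rw [h k l]; simp only [mul_neg, neg_mul, mul_assoc]
      _ = -(M i' j' * (M i j * M k' l') * M k l) := by
        rw [h i j, h k l]; simp only [mul_neg, neg_mul, mul_assoc, neg_neg]
      _ = M i' j' * M k' l' * (M i j * M k l) := by
        rw [h i j k' l']; simp only [mul_neg, neg_mul, mul_assoc, neg_neg]
  have hcomm : IsMulCommutative (Algebra.adjoin ℚ S) := Algebra.isMulCommutative_adjoin ℚ hS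
  let N : Matrix n n (Algebra.adjoin ℚ S) := fun i j =>
    ⟨(M * M) i j, Subalgebra.sum_mem _ fun k _ => Algebra.subset_adjoin ⟨i, k, k, j, rfl⟩⟩
  refine Matrix.pow_two_mul_card_eq_zero_of_sq_eq_map (C := Algebra.adjoin ℚ S) M h
    ((Algebra.adjoin ℚ S).val : _ →+* Γ) Subtype.val_injective N ?_
  rw [pow_two]
  rfl

/-- Write (AB)^(m+1) as A(BA)^m B and cycle the central entries of A. The exponent must be positive,
since the two identity matrices may have different sizes. -/
theorem Matrix.trace_mul_pow_comm {n p Γ : Type*} [Ring Γ] [Fintype n] [Fintype p]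
    [DecidableEq n] [DecidableEq p] (A : Matrix n p Γ) (B : Matrix p n Γ)
    (h : ∀ i j (y : Γ), A i j * y = y * A i j) (m : ℕ) :
    ((A * B) ^ (m + 1)).trace = ((B * A) ^ (m + 1)).trace := by
  have h1 : ∀ m, A * (B * A) ^ m = (A * B) ^ m * A := by
    intro m
    induction m with
    | zero => simp
    | succ m ih => rw [pow_succ, ← Matrix.mul_assoc, ih, pow_succ]; simp only [Matrix.mul_assoc]
  rw [pow_succ, ← Matrix.mul_assoc, ← h1, Matrix.mul_assoc,
    Matrix.trace_mul_comm_of_commute _ _ fun i j => h i j _, pow_succ, Matrix.mul_assoc]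

/-! ### Traces of matrices of one-forms and complementary projectors. -/

theorem anticommute_of_mem_span {K Γ E : Type*} [CommRing K] [Ring Γ] [Algebra K Γ] {θ : E → Γ}
    (hθ : ∀ e f, θ e * θ f = -(θ f * θ e)) {x y : Γ} (hx : x ∈ Submodule.span K (Set.range θ))
    (hy : y ∈ Submodule.span K (Set.range θ)) : x * y = -(y * x) := by
  induction hx, hy using Submodule.span_induction₂ with
  | mem_mem x y hx hy =>
    obtain ⟨e, rfl⟩ := hx
    obtain ⟨f, rfl⟩ := hy
    exact hθ e f
  | zero_left y hy => simp
  | zero_right x hx => simp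
  | add_left x y z _ _ _ h1 h2 => rw [add_mul, h1, h2, mul_add, neg_add]
  | add_right x y z _ _ _ h1 h2 => rw [mul_add, h1, h2, add_mul, neg_add]
  | smul_left r x y _ _ h => rw [smul_mul_assoc, h, mul_smul_comm, smul_neg]
  | smul_right r x y _ _ h => rw [mul_smul_comm, h, smul_mul_assoc, smul_neg]

theorem Matrix.map_mul_diagonal_mul_map_mem_span {K Γ E n p : Type*} [CommRing K] [Ring Γ]
    [Algebra K Γ] [Fintype E] [DecidableEq E] (A : Matrix n E K) (B : Matrix E p K) (θ : E → Γ)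
    (i : n) (j : p) :
    (A.map (algebraMap K Γ) * Matrix.diagonal θ * B.map (algebraMap K Γ)) i j
      ∈ Submodule.span K (Set.range θ) := by
  rw [Matrix.mul_apply]
  refine Submodule.sum_mem _ fun e _ => ?_
  rw [Matrix.mul_diagonal, Matrix.map_apply, Matrix.map_apply, ← Algebra.commutes,
    ← Algebra.smul_def, ← Algebra.smul_def]
  exact Submodule.smul_mem _ _ (Submodule.smul_mem _ _ (Submodule.subset_span ⟨e, rfl⟩))

/-- High powers of the square matrix of one-forms `A diag(θ) B` vanish. -/
theorem Matrix.map_mul_diagonal_mul_map_pow_eq_zero {K Γ E n : Type*} [CommRing K] [Ring Γ]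
    [Algebra ℚ Γ] [Algebra K Γ] [Fintype E] [DecidableEq E] [Fintype n] [DecidableEq n]
    (A : Matrix n E K) (B : Matrix E n K) {θ : E → Γ} (hθ : ∀ e f, θ e * θ f = -(θ f * θ e))
    {m : ℕ} (hm : 2 * Fintype.card n ≤ m) :
    (A.map (algebraMap K Γ) * Matrix.diagonal θ * B.map (algebraMap K Γ)) ^ m = 0 := by
  refine pow_eq_zero_of_le hm (Matrix.pow_two_mul_card_eq_zero_of_anticommute _ fun i j k l => ?_)
  exact anticommute_of_mem_span (K := K) hθ (Matrix.map_mul_diagonal_mul_map_mem_span A B θ i j)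
    (Matrix.map_mul_diagonal_mul_map_mem_span A B θ k l)

/-- With δ = diag(d), δ² = 0 gives δ(1 - P)δ = -δPδ. For even m the two powers therefore add up to
δ(Pδ)^m, whose trace vanishes as well. -/
theorem Matrix.trace_mul_diagonal_pow_eq_neg {Γ E : Type*} [Ring Γ] [Algebra ℚ Γ] [Fintype E]
    [DecidableEq E] (P : Matrix E E Γ) (d : E → Γ) (hd : ∀ e f, d e * d f = -(d f * d e))
    (hP : ∀ i j e, d e * P i j = P i j * d e) {m : ℕ} (hm : Even m) (hm0 : m ≠ 0) :
    (((1 - P) * Matrix.diagonal d) ^ (m + 1)).trace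
      = -((P * Matrix.diagonal d) ^ (m + 1)).trace := by
  have htf : IsAddTorsionFree Γ := .of_module_rat Γ
  have hdd : ∀ e, d e * d e = 0 := fun e => self_eq_neg.1 (hd e e)
  have hδ : Matrix.diagonal d * Matrix.diagonal d = 0 := by
    rw [Matrix.diagonal_mul_diagonal]
    simp [hdd]
  have h1 : ∀ i, Matrix.diagonal d * ((1 - P) * Matrix.diagonal d) ^ i
      = (-1) ^ i * (Matrix.diagonal d * (P * Matrix.diagonal d) ^ i) := by
    intro i
    induction i with
    | zero => simp
    | succ i ih =>
      have h2 : Matrix.diagonal d * ((1 - P) * Matrix.diagonal d)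
          = -(Matrix.diagonal d * P * Matrix.diagonal d) := by
        rw [← mul_assoc, mul_sub, sub_mul, mul_one, hδ, zero_sub]
      rw [pow_succ', ← mul_assoc, h2, neg_mul, mul_assoc, ih, pow_succ', pow_succ' (P * _)]
      rw [← mul_assoc _ ((-1) ^ i), ((Commute.neg_one_left _).pow_left i).eq.symm]
      simp only [mul_assoc, neg_mul, one_mul]
  -- For m > 0 the e-th diagonal entry of (Pδ)^m ends in d e; moving the leading d e next to it
  -- produces a square, which is zero.
  have h3 : (Matrix.diagonal d * (P * Matrix.diagonal d) ^ m).trace = 0 := by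
    refine Finset.sum_eq_zero fun e _ => ?_
    rw [Matrix.diag_apply, Matrix.diagonal_mul,
      Matrix.mul_pow_apply_of_anticommute _ (d e) fun i j => ?_]
    · obtain ⟨k, rfl⟩ := Nat.exists_eq_succ_of_ne_zero hm0
      rw [Nat.succ_eq_add_one, pow_succ (P * _), ← mul_assoc (_ ^ k) P, Matrix.mul_diagonal, mul_assoc (_ : Γ), hdd,
        mul_zero, mul_zero]
    · rw [Matrix.mul_diagonal, ← mul_assoc, hP, mul_assoc, hd, mul_neg, mul_assoc]
  rw [eq_neg_iff_add_eq_zero, pow_succ', mul_assoc, h1, hm.neg_one_pow, one_mul, pow_succ' (P * _),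
    mul_assoc P, ← Matrix.trace_add, ← add_mul, sub_add_cancel, one_mul, h3]

/-- Since A(1 - HA) = 0, the columns of 1 - HA lie in ker A, whose dimension is known because A is
surjective. Expanding them in a basis gives a factorization through the rank. -/
theorem Matrix.exists_one_sub_mul_eq_mul {K E n : Type*} [Field K] [Fintype E] [DecidableEq E]
    [Fintype n] [DecidableEq n] (H : Matrix E n K) (A : Matrix n E K) (h : A * H = 1) :
    ∃ (U : Matrix E (Fin (Fintype.card E - Fintype.card n)) K)
      (W : Matrix (Fin (Fintype.card E - Fintype.card n)) E K), 1 - H * A = U * W := by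
  have hfr : Module.finrank K (LinearMap.ker A.mulVecLin) = Fintype.card E - Fintype.card n := by
    have h1 := A.mulVecLin.finrank_range_add_finrank_ker
    have h2 : LinearMap.range A.mulVecLin = ⊤ := by
      refine LinearMap.range_eq_top.2 fun v => ⟨H.mulVec v, ?_⟩
      rw [Matrix.mulVecLin_apply, Matrix.mulVec_mulVec, h, Matrix.one_mulVec]
    rw [h2, finrank_top, Module.finrank_fintype_fun_eq_card,
      Module.finrank_fintype_fun_eq_card] at h1
    omega
  let b := Module.finBasisOfFinrankEq K (LinearMap.ker A.mulVecLin) hfr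
  have hmem : ∀ e, (1 - H * A).col e ∈ LinearMap.ker A.mulVecLin := by
    intro e
    rw [LinearMap.mem_ker, ← Matrix.mulVec_single_one, Matrix.mulVecLin_apply,
      Matrix.mulVec_mulVec, Matrix.mul_sub, ← Matrix.mul_assoc, h, Matrix.mul_one, Matrix.one_mul,
      sub_self, Matrix.zero_mulVec]
  refine ⟨Matrix.of fun e i => (b i : E → K) e, Matrix.of fun i e => b.repr ⟨_, hmem e⟩ i, ?_⟩
  ext e f
  have h3 := congrArg (fun v : LinearMap.ker A.mulVecLin => (v : E → K) e)
    (b.sum_repr ⟨_, hmem f⟩)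
  simp only [AddSubmonoidClass.coe_finsetSum, Finset.sum_apply, Submodule.coe_smul,
    Pi.smul_apply, smul_eq_mul] at h3
  rw [Matrix.mul_apply]
  simp only [Matrix.of_apply]
  rw [Finset.sum_congr rfl fun i _ => mul_comm _ _, h3]
  rfl

/-- The invariant trace of odd degree `m + 1` of a symmetric matrix `Hᵀ diag(x) H` in
`m + 2` variables vanishes, unless its size is half the number of variables. -/
theorem Matrix.trace_inv_mul_pow_eq_zero {K Γ E n : Type*} [Field K] [Ring Γ]
    [Algebra ℚ Γ] [Algebra K Γ] [Fintype E] [DecidableEq E] [Fintype n] [DecidableEq n]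
    (H : Matrix E n K) (x : E → K) (hx : ∀ e, x e ≠ 0)
    (hΛ : IsUnit (H.transpose * Matrix.diagonal x * H).det) {θ : E → Γ}
    (hθ : ∀ e f, θ e * θ f = -(θ f * θ e)) {m : ℕ} (hm : Even m) (hm0 : m ≠ 0)
    (hE : Fintype.card E = m + 2) (hne : Fintype.card E ≠ 2 * Fintype.card n) :
    (((H.transpose * Matrix.diagonal x * H)⁻¹.map (algebraMap K Γ) *
      (H.transpose.map (algebraMap K Γ) * Matrix.diagonal θ * H.map (algebraMap K Γ)))
        ^ (m + 1)).trace = 0 := by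
  set Λ := H.transpose * Matrix.diagonal x * H with hΛdef
  rw [Matrix.mul_assoc (H.transpose.map _), ← Matrix.mul_assoc, ← Matrix.map_mul,
    ← Matrix.mul_assoc]
  rcases le_or_gt (2 * Fintype.card n) (m + 1) with hle | hlt
  · rw [Matrix.map_mul_diagonal_mul_map_pow_eq_zero _ _ hθ hle, Matrix.trace_zero]
  -- The logarithmic forms dx_e/x_e: absorbing diag(x) into `A` makes HA a projector.
  let δ : E → Γ := fun e => (x e)⁻¹ • θ e
  have hδ : ∀ e f, δ e * δ f = -(δ f * δ e) := fun e f => by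
    simp only [δ, smul_mul_smul_comm, hθ e f, smul_neg, mul_comm (x e)⁻¹]
  let A := Λ⁻¹ * H.transpose * Matrix.diagonal x
  have hAH : A * H = 1 := by
    simp only [A, Matrix.mul_assoc]
    rw [← Matrix.mul_assoc H.transpose, ← hΛdef, Matrix.nonsing_inv_mul _ hΛ]
  have hθδ : Matrix.diagonal θ = (Matrix.diagonal x).map (algebraMap K Γ) * Matrix.diagonal δ := by
    rw [Matrix.diagonal_map (map_zero _), Matrix.diagonal_mul_diagonal]
    congr 1
    ext e
    simp [δ, ← Algebra.smul_def, smul_smul, hx e]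
  obtain ⟨U, W, hUW⟩ := Matrix.exists_one_sub_mul_eq_mul H A hAH
  rw [hθδ, ← Matrix.mul_assoc, ← Matrix.map_mul, ← Matrix.trace_mul_pow_comm (H.map (algebraMap K Γ)) _
      (fun _ _ _ => Algebra.commutes _ _),
    ← Matrix.mul_assoc, ← Matrix.map_mul]
  have h1 : (H * A).map (algebraMap K Γ) = 1 - (U * W).map (algebraMap K Γ) := by
    rw [← hUW, Matrix.map_sub _ (map_sub _), Matrix.map_one _ (map_zero _) (map_one _), sub_sub_cancel]
  rw [h1, Matrix.trace_mul_diagonal_pow_eq_neg ((U * W).map (algebraMap K Γ)) δ hδ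
      (fun _ _ _ => (Algebra.commutes _ _).symm) hm hm0,
    Matrix.map_mul, Matrix.mul_assoc, Matrix.trace_mul_pow_comm (U.map (algebraMap K Γ)) _
      (fun _ _ _ => Algebra.commutes _ _),
    Matrix.map_mul_diagonal_mul_map_pow_eq_zero _ _ hδ, Matrix.trace_zero, neg_zero]
  -- Here 2|n| > m + 1 and 2|n| ≠ m + 2, so 2(m + 2 - |n|) ≤ m + 1, which is the Amitsur-Levitzki
  -- bound for the complementary size.
  rw [Fintype.card_fin]
  omega

/-! ### Primitive elements of the Hopf algebra. -/

open scoped TensorProduct KaehlerDifferential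
namespace OmegaCan

theorem mul_comm_of_mem_wordGrading {i j : ℕ} {a b : OmegaCan} (ha : a ∈ wordGrading i)
    (hb : b ∈ wordGrading j) : a * b = (-1 : ℤˣ) ^ (j * i) • (b * a) := by
  have h1 : ∀ (v : ℕ+ →₀ ℚ) (j : ℕ) (b : OmegaCan), b ∈ wordGrading j →
      ExteriorAlgebra.ι ℚ v * b = (-1 : ℤˣ) ^ j • (b * ExteriorAlgebra.ι ℚ v) := by
    intro v j b hb
    induction hb using Submodule.pow_induction_on_left' with
    | algebraMap r => simp [Algebra.commutes]
    | add x y i _ _ hx hy => rw [mul_add, hx, hy, add_mul, smul_add]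
    | mem_mul m hm i x _ hx =>
      obtain ⟨w, rfl⟩ := hm
      rw [← mul_assoc, eq_neg_of_add_eq_zero_left (ExteriorAlgebra.ι_add_mul_swap v w), neg_mul,
        mul_assoc, hx, mul_smul_comm, mul_assoc, pow_succ, mul_neg_one, Units.neg_smul]
  induction ha using Submodule.pow_induction_on_left' with
  | algebraMap r => simp [Algebra.commutes]
  | add x y i _ _ hx hy => rw [add_mul, hx, hy, mul_add, smul_add]
  | mem_mul m hm i x _ hx =>
    obtain ⟨w, rfl⟩ := hm
    rw [mul_assoc, hx, mul_smul_comm, ← mul_assoc, h1 w j b hb, smul_mul_assoc, smul_smul,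
      mul_assoc, ← pow_add, Nat.mul_succ]

/-- The multiplication of `Ω_can`, a homomorphism as `Ω_can` is graded-commutative. -/
noncomputable def multiplication : TensorSquare →ₐ[ℚ] OmegaCan :=
  GradedTensorProduct.lift wordGrading wordGrading (AlgHom.id ℚ _) (AlgHom.id ℚ _)
    fun _ _ a b => mul_comm_of_mem_wordGrading a.2 b.2

/-- Its eigenvalues 2^r separate the word lengths r, which is how primitivity is exploited. -/
theorem multiplication_comp_coproduct :
    multiplication.comp coproduct
      = ExteriorAlgebra.map ((2 : ℚ) • (LinearMap.id : (ℕ+ →₀ ℚ) →ₗ[ℚ] _)) := by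
  refine ExteriorAlgebra.hom_ext (LinearMap.ext fun v => ?_)
  simp [coproduct, coproductOnGenerators, multiplication, two_smul]

theorem map_two_smul_of_mem_wordGrading {r : ℕ} {x : OmegaCan} (hx : x ∈ wordGrading r) :
    ExteriorAlgebra.map ((2 : ℚ) • (LinearMap.id : (ℕ+ →₀ ℚ) →ₗ[ℚ] _)) x = (2 : ℚ) ^ r • x := by
  induction hx using Submodule.pow_induction_on_left' with
  | algebraMap r => simp
  | add x y i _ _ hx hy => rw [map_add, hx, hy, smul_add]
  | mem_mul m hm i x _ hx =>
    obtain ⟨w, rfl⟩ := hm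
    rw [map_mul, hx, ExteriorAlgebra.map_apply_ι]
    simp [pow_succ', smul_smul, mul_comm]

/-- The component of a canonical form with one generator. -/
noncomputable def linearPart : OmegaCan →ₗ[ℚ] OmegaCan := GradedAlgebra.proj wordGrading 1

/-- Doubling the generators multiplies the component of word length r by 2^r, but multiplies a
primitive element by 2, so the components with r ≠ 1 vanish. -/
theorem IsPrimitive.linearPart_eq {ω : OmegaCan} (h : IsPrimitive ω) : linearPart ω = ω := by
  have h1 : ExteriorAlgebra.map ((2 : ℚ) • (LinearMap.id : (ℕ+ →₀ ℚ) →ₗ[ℚ] _)) ω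
      = (2 : ℚ) • ω := by
    rw [← multiplication_comp_coproduct, AlgHom.comp_apply, h]
    simp [multiplication, two_smul]
  have h2 : ∀ (r : ℕ) (x : OmegaCan), GradedAlgebra.proj wordGrading r
      (ExteriorAlgebra.map ((2 : ℚ) • (LinearMap.id : (ℕ+ →₀ ℚ) →ₗ[ℚ] _)) x)
      = (2 : ℚ) ^ r • GradedAlgebra.proj wordGrading r x := by
    intro r x
    induction x using DirectSum.Decomposition.inductionOn wordGrading with
    | zero => simp
    | @homogeneous i m =>
      rw [map_two_smul_of_mem_wordGrading m.2, map_smul]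
      by_cases hir : i = r
      · subst hir; rfl
      · rw [GradedAlgebra.proj_apply, DirectSum.decompose_of_mem_ne _ m.2 hir]
        simp
    | add x y hx hy => rw [map_add, map_add, hx, hy, map_add, smul_add]
  have h3 : ∀ r, r ≠ 1 → GradedAlgebra.proj wordGrading r ω = 0 := by
    intro r hr
    have h4 := h2 r ω
    rw [h1, map_smul, ← sub_eq_zero, ← sub_smul, smul_eq_zero, sub_eq_zero] at h4
    refine h4.resolve_left fun h5 => hr ?_
    have : (2 : ℚ) ^ 1 = 2 ^ r := by rw [pow_one]; exact h5
    exact (pow_right_injective₀ (by norm_num) (by norm_num) this).symm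
  classical
  conv_rhs => rw [← DirectSum.sum_support_decompose wordGrading ω]
  rw [Finset.sum_eq_single 1]
  · rfl
  · exact fun r _ hr => h3 r hr
  · intro h6
    rw [DFinsupp.notMem_support_iff] at h6
    rw [h6]; rfl

/-- A product of generators has word length equal to its number of factors, so only single
generators survive the projection. -/
theorem linearPart_mem_span {k : ℕ} {ω : OmegaCan} (hω : ω ∈ homogeneous k) :
    linearPart ω ∈ Submodule.span ℚ {x | ∃ j : ℕ+, 4 * (j : ℕ) + 1 = k ∧ x = β j} := by
  induction hω using Submodule.span_induction with
  | zero => simp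
  | add x y _ _ hx hy => rw [map_add]; exact Submodule.add_mem _ hx hy
  | smul a x _ hx => rw [map_smul]; exact Submodule.smul_mem _ _ hx
  | mem x hx =>
    obtain ⟨l, hl, rfl⟩ := hx
    have hβ : ∀ l : List ℕ+, (l.map β).prod ∈ wordGrading l.length := by
      intro l
      induction l with
      | nil => exact SetLike.GradedOne.one_mem (A := wordGrading)
      | cons a l ih =>
        rw [List.map_cons, List.prod_cons, List.length_cons]
        exact (pow_succ' (LinearMap.range (ExteriorAlgebra.ι ℚ)) l.length).ge
          (Submodule.mul_mem_mul ⟨_, rfl⟩ ih)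
    by_cases h1 : l.length = 1
    · obtain ⟨j, rfl⟩ := List.length_eq_one_iff.1 h1
      refine Submodule.subset_span ⟨j, by simpa using hl, ?_⟩
      rw [linearPart, GradedAlgebra.proj_apply, ← List.length_singleton (a := j),
        DirectSum.decompose_of_mem_same _ (hβ [j])]
      simp
    · rw [linearPart, GradedAlgebra.proj_apply, DirectSum.decompose_of_mem_ne _ (hβ l) h1]
      exact Submodule.zero_mem _

/-- A primitive canonical form is a multiple of a generator. -/
theorem IsPrimitive.mem_span {k : ℕ} {ω : OmegaCan} (h : IsPrimitive ω) (hω : ω ∈ homogeneous k) :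
    ω ∈ Submodule.span ℚ {x | ∃ j : ℕ+, 4 * (j : ℕ) + 1 = k ∧ x = β j} := by
  rw [← h.linearPart_eq]
  exact linearPart_mem_span hω

end OmegaCan

/-! ### Forms on the complement of the graph hypersurface, over a field. -/

noncomputable section
namespace MultiGraph

variable (G : MultiGraph)

/-- The forms with constant coefficients. -/
abbrev ConstForms : Type := ExteriorAlgebra ℚ (G.E → ℚ)

/-- The differentials `dx_e`, as forms with constant coefficients. -/
def constDx (e : G.E) : G.ConstForms := by
  classical
  exact ExteriorAlgebra.ι ℚ (Pi.single e 1)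

/-- One-forms as combinations of the constant forms `dx_e`. -/
def oneFormToTensor : Ω[G.R0⁄ℚ] →ₗ[G.R0] G.R0 ⊗[ℚ] G.ConstForms :=
  G.dxBasis.constr ℚ fun e => 1 ⊗ₜ G.constDx e

theorem constDx_mul (e f : G.E) : G.constDx e * G.constDx f = -(G.constDx f * G.constDx e) :=
  eq_neg_of_add_eq_zero_left (ExteriorAlgebra.ι_add_mul_swap _ _)

theorem oneFormToTensor_mul_self (v : Ω[G.R0⁄ℚ]) :
    G.oneFormToTensor v * G.oneFormToTensor v = 0 := by
  have hmem : ∀ v, G.oneFormToTensor v ∈ Submodule.span G.R0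
      (Set.range fun e => (1 : G.R0) ⊗ₜ[ℚ] G.constDx e) := by
    intro v
    rw [oneFormToTensor, Module.Basis.constr_apply_fintype]
    exact Submodule.sum_mem _ fun e _ => Submodule.smul_mem _ _ (Submodule.subset_span ⟨e, rfl⟩)
  have htf : IsAddTorsionFree (G.R0 ⊗[ℚ] G.ConstForms) := .of_module_rat _
  refine self_eq_neg.1 (anticommute_of_mem_span (fun e f => ?_) (hmem v) (hmem v))
  simp only [Algebra.TensorProduct.tmul_mul_tmul, G.constDx_mul e f, TensorProduct.tmul_neg]

/-- Forms as combinations of forms with constant coefficients. -/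
def formsToTensor : G.Forms →ₐ[G.R0] G.R0 ⊗[ℚ] G.ConstForms :=
  ExteriorAlgebra.lift G.R0 ⟨G.oneFormToTensor, G.oneFormToTensor_mul_self⟩

/-- The inclusion of the forms with constant coefficients. -/
def constToForms : G.ConstForms →ₐ[ℚ] G.Forms :=
  ExteriorAlgebra.lift ℚ ⟨((ExteriorAlgebra.ι G.R0).restrictScalars ℚ).comp
    ((Pi.basisFun ℚ G.E).constr ℚ G.dxBasis), fun _ => ExteriorAlgebra.ι_sq_zero _⟩

/-- A left inverse multiplies coefficients with constant forms; that it is one need only be checked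
on the basis dx_e. -/
theorem formsToTensor_injective : Function.Injective G.formsToTensor := by
  classical
  let Ψ : G.R0 ⊗[ℚ] G.ConstForms →ₐ[G.R0] G.Forms :=
    Algebra.TensorProduct.lift (Algebra.ofId G.R0 G.Forms) G.constToForms
      fun a b => Algebra.commutes a _
  have h : Ψ.comp G.formsToTensor = AlgHom.id G.R0 _ := by
    refine ExteriorAlgebra.hom_ext (G.dxBasis.ext fun e => ?_)
    have h1 : G.formsToTensor (ExteriorAlgebra.ι G.R0 (G.dxBasis e)) = 1 ⊗ₜ G.constDx e := by
      rw [formsToTensor, ExteriorAlgebra.lift_ι_apply, oneFormToTensor,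
        Module.Basis.constr_basis]
    have h2 : G.constToForms (G.constDx e) = ExteriorAlgebra.ι G.R0 (G.dxBasis e) := by
      have : (Pi.single e (1 : ℚ) : G.E → ℚ) = Pi.basisFun ℚ G.E e := by simp
      refine (ExteriorAlgebra.lift_ι_apply ℚ _ _ _).trans ?_
      rw [LinearMap.comp_apply, this, Module.Basis.constr_basis]
      rfl
    change Ψ (G.formsToTensor (ExteriorAlgebra.ι G.R0 (G.dxBasis e))) = _
    rw [h1]
    refine (Algebra.TensorProduct.lift_tmul _ _ _ _ _).trans ?_
    rw [map_one, one_mul, h2]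
    rfl
  exact Function.LeftInverse.injective (g := Ψ) fun x => DFunLike.congr_fun h x

theorem dxBasis_apply (e : G.E) :
    G.dxBasis e = KaehlerDifferential.D ℚ G.R0 (algebraMap G.Poly G.R0 (MvPolynomial.X e)) := by
  have : Algebra.FormallyEtale G.Poly G.R0 :=
    Algebra.FormallyEtale.of_isLocalization (Submonoid.powers G.graphPoly)
  rw [dxBasis, Module.Basis.map_apply, Module.Basis.baseChange_apply,
    KaehlerDifferential.mvPolynomialBasis_apply]
  simp

/-- The field of rational functions on the complement of the graph hypersurface. -/
abbrev RatFun : Type := FractionRing G.R0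

/-- The forms with rational coefficients. -/
abbrev RatForms : Type := G.RatFun ⊗[ℚ] G.ConstForms

/-- The inclusion of regular forms into forms with rational coefficients. -/
def formsToRat : G.Forms →+* G.RatForms :=
  (Algebra.TensorProduct.map (IsScalarTower.toAlgHom ℚ G.R0 G.RatFun)
    (AlgHom.id ℚ G.ConstForms)).toRingHom.comp G.formsToTensor.toRingHom

/-- The constant forms are flat over ℚ, so enlarging the coefficients to the fraction ring loses
nothing. Vanishing can thus be tested where linear algebra over a field applies. -/
theorem formsToRat_injective : Function.Injective G.formsToRat := by
  refine Function.Injective.comp (g := Algebra.TensorProduct.map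
    (IsScalarTower.toAlgHom ℚ G.R0 G.RatFun) (AlgHom.id ℚ G.ConstForms))
    (f := G.formsToTensor) ?_ G.formsToTensor_injective
  exact Module.Flat.rTensor_preserves_injective_linearMap (M := G.ConstForms)
    (IsScalarTower.toAlgHom ℚ G.R0 G.RatFun).toLinearMap (IsFractionRing.injective _ _)

theorem formsToRat_algebraMap (r : G.R0) : G.formsToRat (algebraMap G.R0 G.Forms r)
    = algebraMap G.RatFun G.RatForms (algebraMap G.R0 G.RatFun r) := by
  change Algebra.TensorProduct.map _ _ (G.formsToTensor (algebraMap G.R0 G.Forms r)) = _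
  rw [AlgHom.commutes, Algebra.TensorProduct.algebraMap_apply, Algebra.TensorProduct.map_tmul]
  simp

theorem formsToRat_ι_dx (e : G.E) :
    G.formsToRat (ExteriorAlgebra.ι G.R0 (G.dxBasis e)) = 1 ⊗ₜ G.constDx e := by
  change Algebra.TensorProduct.map _ _ (G.formsToTensor _) = _
  rw [formsToTensor, ExteriorAlgebra.lift_ι_apply, oneFormToTensor, Module.Basis.constr_basis,
    Algebra.TensorProduct.map_tmul]
  simp

/-- The edge-cycle incidence matrix, over the rational functions. -/
def ratCycleMatrix : Matrix G.E (Fin G.loops) G.RatFun :=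
  Matrix.of fun e c => (((G.cycleBasis c : G.E → ℤ) e : ℤ) : G.RatFun)

/-- The coordinate `x_e` as a rational function. -/
def ratCoord (e : G.E) : G.RatFun :=
  algebraMap G.R0 G.RatFun (algebraMap G.Poly G.R0 (MvPolynomial.X e))

/-- Integer coefficients let additive maps, including the differential, pass through the sum. -/
theorem laplacian_apply (c c' : Fin G.loops) : G.laplacian c c'
    = ∑ e, (((G.cycleBasis c : G.E → ℤ) e * (G.cycleBasis c' : G.E → ℤ) e : ℤ) : ℤ) •
      (MvPolynomial.X e : G.Poly) := by
  classical
  rw [laplacian, Matrix.mul_apply]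
  refine Finset.sum_congr rfl fun e _ => ?_
  rw [Matrix.mul_diagonal, Matrix.transpose_apply, cycleMatrix]
  simp only [Matrix.of_apply, zsmul_eq_mul, Int.cast_mul]
  ring

theorem laplacian_map_ratFun [DecidableEq G.E] :
    (G.laplacian.map (algebraMap G.Poly G.R0)).map (algebraMap G.R0 G.RatFun)
      = G.ratCycleMatrix.transpose * Matrix.diagonal G.ratCoord * G.ratCycleMatrix := by
  ext c c'
  rw [Matrix.map_apply, Matrix.map_apply, laplacian_apply, map_sum, map_sum, Matrix.mul_apply]
  refine Finset.sum_congr rfl fun e _ => ?_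
  rw [map_zsmul, map_zsmul, Matrix.mul_diagonal, Matrix.transpose_apply, ratCycleMatrix]
  simp only [Matrix.of_apply, zsmul_eq_mul, Int.cast_mul, ratCoord]
  ring

theorem formsToRat_ι_laplacian [DecidableEq G.E] :
    ((G.laplacian.map (algebraMap G.Poly G.R0)).map fun a =>
      ExteriorAlgebra.ι G.R0 (KaehlerDifferential.D ℚ G.R0 a)).map G.formsToRat
    = G.ratCycleMatrix.transpose.map (algebraMap G.RatFun G.RatForms) *
      Matrix.diagonal (fun e => (1 : G.RatFun) ⊗ₜ[ℚ] G.constDx e) *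
      G.ratCycleMatrix.map (algebraMap G.RatFun G.RatForms) := by
  ext c c'
  rw [Matrix.map_apply, Matrix.map_apply, Matrix.map_apply, laplacian_apply, map_sum, map_sum,
    map_sum, map_sum, Matrix.mul_apply]
  refine Finset.sum_congr rfl fun e _ => ?_
  rw [map_zsmul, map_zsmul, map_zsmul, map_zsmul, ← dxBasis_apply, formsToRat_ι_dx,
    Matrix.mul_diagonal, Matrix.map_apply, Matrix.map_apply, Matrix.transpose_apply,
    ratCycleMatrix]
  simp only [Matrix.of_apply, map_intCast, zsmul_eq_mul, Int.cast_mul]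
  rw [mul_assoc, mul_assoc, (Int.cast_commute _ ((1 : G.RatFun) ⊗ₜ[ℚ] G.constDx e)).eq]

theorem isDomain_R0 (h : G.graphPoly ≠ 0) : IsDomain G.R0 :=
  IsLocalization.isDomain_localization (powers_le_nonZeroDivisors_of_noZeroDivisors h)

theorem ratCoord_ne_zero (h : G.graphPoly ≠ 0) (e : G.E) : G.ratCoord e ≠ 0 := by
  have := G.isDomain_R0 h
  rw [ratCoord, Ne, IsFractionRing.to_map_eq_zero_iff,
    IsLocalization.to_map_eq_zero_iff G.R0 (powers_le_nonZeroDivisors_of_noZeroDivisors h)]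
  exact MvPolynomial.X_ne_zero e

theorem isUnit_det_laplacian : IsUnit (G.laplacian.map (algebraMap G.Poly G.R0)).det := by
  have h := IsLocalization.Away.algebraMap_isUnit (S := G.R0) G.graphPoly
  exact (RingHom.map_det (algebraMap G.Poly G.R0) G.laplacian) ▸ h

theorem primitiveForm_eq_zero {k : ℕ} (hk : k ≠ 0) (hE : G.numEdges = 4 * k + 2)
    (hne : G.numEdges ≠ 2 * G.loops) : G.primitiveForm k = 0 := by
  classical
  by_cases hΨ : G.graphPoly = 0
  -- Inverting zero gives the zero ring, over which every form vanishes.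
  · have h0 : (1 : G.R0) = 0 := by
      have h1 := IsLocalization.Away.algebraMap_isUnit (S := G.R0) G.graphPoly
      have h2 : algebraMap G.Poly G.R0 G.graphPoly = 0 :=
        (congrArg (algebraMap G.Poly G.R0) hΨ).trans (map_zero _)
      exact (isUnit_zero_iff.1 (h2 ▸ h1)).symm
    rw [← one_smul G.R0 (G.primitiveForm k), h0, zero_smul]
  have := G.isDomain_R0 hΨ
  apply G.formsToRat_injective
  set X := G.laplacian.map (algebraMap G.Poly G.R0) with hX
  have hunit : IsUnit (X.map (algebraMap G.R0 G.RatFun)).det := by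
    have h := G.isUnit_det_laplacian.map (algebraMap G.R0 G.RatFun)
    rwa [RingHom.map_det] at h
  have hinv : (X⁻¹).map (algebraMap G.R0 G.RatFun) = (X.map (algebraMap G.R0 G.RatFun))⁻¹ := by
    refine (Matrix.inv_eq_left_inv ?_).symm
    rw [← Matrix.map_mul, Matrix.nonsing_inv_mul _ G.isUnit_det_laplacian,
      Matrix.map_one _ (map_zero _) (map_one _)]
  have h1 : G.formsToRat (G.primitiveForm k)
      = (((maurerCartan (KaehlerDifferential.D ℚ G.R0) X).map G.formsToRat) ^ (4 * k + 1)).trace := by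
    rw [← Matrix.map_pow]
    unfold primitiveForm invariantTrace
    exact AddMonoidHom.map_trace G.formsToRat _
  have h2 : ((X⁻¹).map (algebraMap G.R0 G.Forms)).map G.formsToRat
      = ((X⁻¹).map (algebraMap G.R0 G.RatFun)).map (algebraMap G.RatFun G.RatForms) := by
    ext i j
    exact G.formsToRat_algebraMap _
  rw [h1, map_zero, maurerCartan, Matrix.map_mul, h2, hinv, hX, formsToRat_ι_laplacian,
    laplacian_map_ratFun]
  refine Matrix.trace_inv_mul_pow_eq_zero G.ratCycleMatrix G.ratCoord (G.ratCoord_ne_zero hΨ) ?_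
    (fun e f => ?_) ⟨2 * k, by ring⟩ (by omega) hE ?_
  · rwa [← laplacian_map_ratFun]
  · simp only [Algebra.TensorProduct.tmul_mul_tmul, G.constDx_mul e f, TensorProduct.tmul_neg]
  · rwa [Fintype.card_fin]

/-- Primitive canonical forms vanish on graphs of non-zero degree with one more edge than the
degree of the form. -/
theorem canonicalForm_eq_zero {k : ℕ} {ω : OmegaCan} (hω : ω ∈ OmegaCan.homogeneous k)
    (hprim : OmegaCan.IsPrimitive ω) (hE : G.numEdges = k + 1)
    (hne : G.numEdges ≠ 2 * G.loops) : G.canonicalForm ω = 0 := by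
  have h := hprim.mem_span hω
  refine Submodule.span_le (p := LinearMap.ker G.canonicalForm.toLinearMap).2 ?_ h
  rintro _ ⟨j, rfl, rfl⟩
  change G.canonicalForm (OmegaCan.β j) = 0
  rw [canonicalForm, OmegaCan.β, ExteriorAlgebra.lift_ι_apply, formOnGenerators,
    Finsupp.linearCombination_single, one_smul]
  exact G.primitiveForm_eq_zero j.ne_zero hE hne

end MultiGraph
end

theorem mainTheorem8 (k : ℕ) (ω : OmegaCan) (hω : ω ∈ OmegaCan.homogeneous k)
    (hprim : OmegaCan.IsPrimitive ω) :
    (∀ G : MultiGraph, G.IsConnected → G.numEdges = k + 1 → G.numEdges ≠ 2 * G.loops →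
      G.canonicalForm ω = 0 ∧
        ∀ o : Fin (k + 1) ≃ G.E, G.canonicalIntegral o ω = 0) ∧
    (∀ (p : ℤ) (ξ : GraphComplex.Homology p), GraphComplex.Detects k ω ξ → p = 0) := by
  have hI : ∀ G : MultiGraph, G.numEdges = k + 1 → G.numEdges ≠ 2 * G.loops →
      ∀ o : Fin (k + 1) ≃ G.E, G.canonicalIntegral o ω = 0 := by
    intro G hE hne o
    -- Both the evaluation map and the default value on the hypersurface give zero.
    have h0 : ∀ x, G.realValue 0 x = 0 := fun x => by
      unfold MultiGraph.realValue
      split_ifs <;> simp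
    rw [MultiGraph.canonicalIntegral, G.canonicalForm_eq_zero hω hprim hE hne,
      MultiGraph.simplexIntegral]
    simp [h0]
  refine ⟨fun G _ hE hne => ⟨G.canonicalForm_eq_zero hω hprim hE hne, hI G hE hne⟩, ?_⟩
  -- The class plays no role: the integral vanishes term by term on any chain supported in degree p
  -- ≠ 0.
  rintro p ξ ⟨z, -, hz⟩
  by_contra hp
  refine hz ?_
  rw [GraphComplex.integral, Finsupp.linearCombination_apply]
  refine Finset.sum_eq_zero fun X hX => ?_
  have hdeg : X.G.degree = p := z.2.1 hX
  dsimp only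
  split_ifs with hn
  · have hcard : X.G.numEdges = k + 1 := by
      rw [← hn, MultiGraph.numEdges, ← Fintype.card_congr X.ord, Fintype.card_fin]
    rw [hI X.G hcard fun h => hp ?_, smul_zero]
    rw [← hdeg, MultiGraph.degree, h]
    push_cast
    ring
  · exact smul_zero _
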